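/- Let $X$ be a set and let $F=F(X)$ be the free group on $X$. A \emph{proper free splitting} $A*B$ of $F$ is a pair $(A,B)$ of proper subgroups of $F$ such that $F$ is the (internal) free product of $A$ and $B$; two such splittings $A*B$ and $C*D$ are equivalent if there is $x\in F$ such that $A=xCx^{-1}$ and $B=xDx^{-1}$, or $A=xDx^{-1}$ and $B=xCx^{-1}$, and $[A*B]$ denotes the equivalence class. A \emph{cyclic word} is a cyclically ordered finite sequence of letters of $X\cup X^{-1}$ in which no two cyclically consecutive letters are inverse to each other; cyclic words correspond to the conjugacy classes of $F$, and the elements of the corresponding class are the representatives of the cyclic word. A cyclic word is nontrivial if it is not empty, and \emph{primitive} if some representative of it has the form $\phi(x)$ with $\phi\in\mathrm{Aut}(F)$ and $x\in X$. A cyclic word is \emph{elliptic} to $[A*B]$ if it has a representative that lies in a conjugate of $A$ or in a conjugate of $B$. The \emph{ellipticity graph} $\mathcal Z(F)$ is the bipartite graph whose vertices are the classes $[A*B]$ of proper free splittings of $F$ and the nontrivial cyclic words of $F$, where $[A*B]$ and $w$ are adjacent whenever $w$ is elliptic to $[A*B]$. Let $\mathcal Z'(F)$ be the subgraph of $\mathcal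 Z(F)$ spanned by all classes of proper free splittings and the primitive cyclic words. \textbf{Corollary.} The inclusion $\mathcal Z'(F)\hookrightarrow\mathcal Z(F)$ is an isometric embedding: for all vertices $u,v$ of $\mathcal Z'(F)$, the distance between $u$ and $v$ in $\mathcal Z'(F)$ equals their distance in $\mathcal Z(F)$ (where the distance is $\infty$ if there is no path between them). -/

import Mathlib

/-- A free splitting `A * B` of `G`: the canonical homomorphism from the free product of the
subgroups `A` and `B` to `G` is an isomorphism. -/
def IsFreeSplitting {G : Type*} [Group G] (A B : Subgroup G) : Prop :=
  Function.Bijective (Monoid.Coprod.lift A.subtype B.subtype : Monoid.Coprod A B →* G)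

/-- A proper free splitting: an ordered pair of proper subgroups which is a free splitting. -/
structure ProperFreeSplitting (G : Type*) [Group G] where
  /-- the first free factor -/
  left : Subgroup G
  /-- the second free factor -/
  right : Subgroup G
  isFreeSplitting : IsFreeSplitting left right
  left_ne_top : left ≠ ⊤
  right_ne_top : right ≠ ⊤

/-- The conjugate subgroup `x A x⁻¹`. -/
def conjSubgroup {G : Type*} [Group G] (x : G) (A : Subgroup G) : Subgroup G :=
  A.map (MulAut.conj x).toMonoidHom

theorem mem_conjSubgroup {G : Type*} [Group G] {x g : G} {A : Subgroup G} :
    g ∈ conjSubgroup x A ↔ ∃ a ∈ A, x * a * x⁻¹ = g := by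
  simp [conjSubgroup, Subgroup.mem_map, MulAut.conj_apply]

theorem conjSubgroup_one {G : Type*} [Group G] (A : Subgroup G) : conjSubgroup 1 A = A := by
  ext g; simp [mem_conjSubgroup]

theorem conjSubgroup_mul {G : Type*} [Group G] (x y : G) (A : Subgroup G) :
    conjSubgroup x (conjSubgroup y A) = conjSubgroup (x * y) A := by
  simp [conjSubgroup, Subgroup.map_map, ← MulEquiv.coe_monoidHom_trans, map_mul]
  rfl

namespace ProperFreeSplitting

/-- Equivalence of splittings: simultaneous conjugation of the factors, up to swapping them. -/
def Equivalent {G : Type*} [Group G] (S T : ProperFreeSplitting G) : Prop :=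
  ∃ x : G, (S.left = conjSubgroup x T.left ∧ S.right = conjSubgroup x T.right) ∨
    (S.left = conjSubgroup x T.right ∧ S.right = conjSubgroup x T.left)

theorem equivalent_equivalence (G : Type*) [Group G] :
    Equivalence (Equivalent : ProperFreeSplitting G → ProperFreeSplitting G → Prop) where
  refl S := ⟨1, Or.inl ⟨(conjSubgroup_one _).symm, (conjSubgroup_one _).symm⟩⟩
  symm := by
    rintro S T ⟨x, ⟨h₁, h₂⟩ | ⟨h₁, h₂⟩⟩
    · exact ⟨x⁻¹, Or.inl (by simp [h₁, h₂, conjSubgroup_mul, conjSubgroup_one])⟩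
    · exact ⟨x⁻¹, Or.inr (by simp [h₁, h₂, conjSubgroup_mul, conjSubgroup_one])⟩
  trans := by
    rintro S T U ⟨x, ⟨h₁, h₂⟩ | ⟨h₁, h₂⟩⟩ ⟨y, ⟨k₁, k₂⟩ | ⟨k₁, k₂⟩⟩
    · exact ⟨x * y, Or.inl (by simp [h₁, h₂, k₁, k₂, conjSubgroup_mul])⟩
    · exact ⟨x * y, Or.inr (by simp [h₁, h₂, k₁, k₂, conjSubgroup_mul])⟩
    · exact ⟨x * y, Or.inr (by simp [h₁, h₂, k₁, k₂, conjSubgroup_mul])⟩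
    · exact ⟨x * y, Or.inl (by simp [h₁, h₂, k₁, k₂, conjSubgroup_mul])⟩

/-- The setoid of equivalent proper free splittings. -/
instance setoid (G : Type*) [Group G] : Setoid (ProperFreeSplitting G) :=
  ⟨Equivalent, equivalent_equivalence G⟩

/-- `g` is elliptic to `A * B`: it lies in a conjugate of `A` or in a conjugate of `B`. -/
def IsElliptic {G : Type*} [Group G] (S : ProperFreeSplitting G) (g : G) : Prop :=
  ∃ x : G, g ∈ conjSubgroup x S.left ∨ g ∈ conjSubgroup x S.right

theorem IsElliptic.of_equivalent {G : Type*} [Group G] {S T : ProperFreeSplitting G} {g : G}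
    (h : Equivalent S T) (hg : S.IsElliptic g) : T.IsElliptic g := by
  obtain ⟨x, ⟨h₁, h₂⟩ | ⟨h₁, h₂⟩⟩ := h <;> obtain ⟨y, hy⟩ := hg <;>
    rw [h₁, h₂, conjSubgroup_mul, conjSubgroup_mul] at hy
  · exact ⟨y * x, hy⟩
  · exact ⟨y * x, hy.symm⟩

end ProperFreeSplitting

/-- The classes `[A * B]` of proper free splittings of `G`. -/
def SplittingClass (G : Type*) [Group G] : Type _ :=
  Quotient (ProperFreeSplitting.setoid G)

/-- `g` is elliptic to the class `[A * B]`. -/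
def SplittingClass.IsElliptic {G : Type*} [Group G] (c : SplittingClass G) (g : G) : Prop :=
  Quotient.liftOn c (fun S => S.IsElliptic g) fun _ _ h =>
    propext ⟨fun k => k.of_equivalent h,
      fun k => k.of_equivalent ((ProperFreeSplitting.equivalent_equivalence G).symm h)⟩

/-- Cyclic words over `X ∪ X⁻¹`: the letter `(x, true)` is `x` and `(x, false)` is `x⁻¹`. Lists of
letters are taken up to rotation, and no two cyclically consecutive letters are mutually inverse. -/
def CyclicWord (X : Type*) : Type _ :=
  {w : Cycle (X × Bool) // w.Chain fun a b => b ≠ (a.1, !a.2)}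

namespace CyclicWord

/-- The conjugacy class of the free group on `X` that corresponds to a cyclic word. -/
def conjClass {X : Type*} (w : CyclicWord X) : ConjClasses (FreeGroup X) :=
  Quotient.liftOn w.1 (fun l => ConjClasses.mk (FreeGroup.mk l)) (by
    rintro l _ ⟨n, rfl⟩
    rw [ConjClasses.mk_eq_mk_iff_isConj, isConj_iff]
    refine ⟨(FreeGroup.mk (l.take (n % l.length)))⁻¹, ?_⟩
    have h : FreeGroup.mk l =
        FreeGroup.mk (l.take (n % l.length)) * FreeGroup.mk (l.drop (n % l.length)) := by
      rw [FreeGroup.mul_mk, List.take_append_drop]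
    rw [List.rotate_eq_drop_append_take_mod, ← FreeGroup.mul_mk, h]
    group)

/-- `g` represents the cyclic word `w`: it lies in the conjugacy class corresponding to `w`. -/
def Represents {X : Type*} (g : FreeGroup X) (w : CyclicWord X) : Prop :=
  ConjClasses.mk g = w.conjClass

/-- A cyclic word is nontrivial if it is not the empty word. -/
def IsNontrivial {X : Type*} (w : CyclicWord X) : Prop :=
  w.1 ≠ Cycle.nil

end CyclicWord

/-- An element of the free group on `X` is primitive if it is the image of some letter `x` in `X`
under an automorphism. -/
def IsPrimitiveElement {X : Type*} (g : FreeGroup X) : Prop :=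
  ∃ (φ : FreeGroup X ≃* FreeGroup X) (x : X), g = φ (FreeGroup.of x)

/-- A cyclic word is primitive if some representative of it is primitive. -/
def CyclicWord.IsPrimitive {X : Type*} (w : CyclicWord X) : Prop :=
  ∃ g : FreeGroup X, CyclicWord.Represents g w ∧ IsPrimitiveElement g

/-- A cyclic word is elliptic to a class of splittings if some representative of it is. -/
def CyclicWord.IsEllipticTo {X : Type*} (w : CyclicWord X) (c : SplittingClass (FreeGroup X)) :
    Prop :=
  ∃ g : FreeGroup X, CyclicWord.Represents g w ∧ c.IsElliptic g

/-- The vertices of the ellipticity graph of the free group on `X`: the classes of proper free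
splittings together with the nontrivial cyclic words. -/
abbrev EllipticityVertex (X : Type*) : Type _ :=
  SplittingClass (FreeGroup X) ⊕ {w : CyclicWord X // w.IsNontrivial}

/-- The ellipticity graph of the free group on `X`. -/
def ellipticityGraph (X : Type*) : SimpleGraph (EllipticityVertex X) where
  Adj
    | Sum.inl c, Sum.inr w => w.1.IsEllipticTo c
    | Sum.inr w, Sum.inl c => w.1.IsEllipticTo c
    | _, _ => False
  symm := ⟨by rintro (c | w) (d | v) h <;> exact h⟩
  loopless := ⟨by rintro (c | w) h <;> exact h⟩

/-- All classes of proper free splittings, but only the primitive cyclic words. -/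
def primitiveVertices (X : Type*) : Set (EllipticityVertex X) :=
  {v | ∀ w, v = Sum.inr w → w.1.IsPrimitive}

/-- The subgraph of the ellipticity graph spanned by all classes of proper free splittings and the
primitive cyclic words. -/
def primitiveEllipticityGraph (X : Type*) : SimpleGraph (primitiveVertices X) :=
  (ellipticityGraph X).induce (primitiveVertices X)

/-- The inclusion of the subgraph into the ellipticity graph. -/
def primitiveInclusion (X : Type*) : primitiveEllipticityGraph X ↪g ellipticityGraph X :=
  SimpleGraph.Embedding.induce (primitiveVertices X)

/-! The graph is bipartite, so a walk between vertices of the primitive subgraph meets a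
non-primitive word only between two splitting classes. It suffices to replace that word by a
primitive one elliptic to both classes (`exists_isPrimitive_isEllipticTo`); lengths do not change.

A nontrivial representative lies in a free factor `A` given by one class and, after conjugation, in
a free factor `C` given by the other, so the task is to find a primitive element in `A ∩ C`
(`exists_isPrimitiveElement_mem`). Choose a basis of the free group in which `C` is generated by a
set `Y` of letters, and a Schreier transversal of `A` whose representatives of cosets meeting `⟨Y⟩`
lie in `⟨Y⟩`. If all Schreier generators with letter in `Y` at such cosets were trivial, the
transversal would fix `⟨Y⟩` pointwise, forcing `A ∩ ⟨Y⟩ = 1`. Hence some member of a basis of `A`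
lies in `C`; a basis of the complement of `A` extends this basis to one of the whole group, so that
member is primitive. Nothing here requires finite rank. -/

/-- Recursion along a parent function that decreases a well-founded height. -/
theorem exists_label_of_parent {Q G β : Type*} [Group G] [LT β] [WellFoundedLT β] (μ : Q → β)
    (q₀ : Q) (p : Q → Q) (a : Q → G) (hμ : ∀ q, q ≠ q₀ → μ (p q) < μ q) :
    ∃ t : Q → G, t q₀ = 1 ∧ ∀ q, q ≠ q₀ → t q = a q * t (p q) := by
  classical
  have wf : WellFounded fun x y : Q => μ x < μ y := InvImage.wf μ wellFounded_lt
  let t : Q → G := wf.fix fun q ih => if h : q = q₀ then 1 else a q * ih (p q) (hμ q h)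
  have ht : ∀ q, t q = if q = q₀ then 1 else a q * t (p q) := fun q => by
    simp only [t]
    rw [wf.fix_eq]
    split_ifs <;> rfl
  exact ⟨t, by rw [ht, if_pos rfl], fun q hq => by rw [ht, if_neg hq]⟩

/-! ### Schreier transversals adapted to a standard free factor. -/

namespace FreeGroup

variable {S : Type*}

theorem mk_mem_closure_of {Y : Set S} {w : List (S × Bool)} (hw : ∀ x ∈ w, x.1 ∈ Y) :
    mk w ∈ Subgroup.closure (of '' Y) := by
  induction w with
  | nil => exact one_mem _
  | cons x w ih =>
    have h : mk (x :: w) = mk [x] * mk w := by simp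
    rw [h]
    refine mul_mem ?_ (ih fun y hy => hw y (List.mem_cons_of_mem _ hy))
    have hx : of x.1 ∈ Subgroup.closure (of '' Y) :=
      Subgroup.subset_closure ⟨x.1, hw x List.mem_cons_self, rfl⟩
    obtain ⟨s, _ | _⟩ := x
    · exact inv_mem hx
    · exact hx

theorem exists_mk_eq_of_mem_closure {Y : Set S} {g : FreeGroup S}
    (hg : g ∈ Subgroup.closure (of '' Y)) :
    ∃ w : List (S × Bool), (∀ x ∈ w, x.1 ∈ Y) ∧ mk w = g := by
  induction hg using Subgroup.closure_induction with
  | mem g hg =>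
    obtain ⟨y, hy, rfl⟩ := hg
    exact ⟨[(y, true)], by simpa using hy, rfl⟩
  | one => exact ⟨[], by simp, rfl⟩
  | mul g h _ _ ihg ihh =>
    obtain ⟨w, hw, rfl⟩ := ihg
    obtain ⟨v, hv, rfl⟩ := ihh
    exact ⟨w ++ v, fun x hx => (List.mem_append.1 hx).elim (hw x) (hv x), mul_mk.symm⟩
  | inv g _ ih =>
    obtain ⟨w, hw, rfl⟩ := ih
    refine ⟨invRev w, fun x hx => ?_, inv_mk.symm⟩
    simp only [invRev, List.mem_reverse, List.mem_map] at hx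
    obtain ⟨y, hy, rfl⟩ := hx
    exact hw y hy

/-- A Schreier transversal of the subgroup `A`, as a map on left cosets: representatives are built
by multiplying on the left by one letter at a time. -/
structure IsSchreierTransversal (A : Subgroup (FreeGroup S)) (t : FreeGroup S ⧸ A → FreeGroup S) :
    Prop where
  one : t (1 : FreeGroup S) = 1
  mk_eq : ∀ c, (t c : FreeGroup S ⧸ A) = c
  -- This plays the role of prefix-closedness: the edges along which `t` is multiplicative connect
  -- every coset to the trivial one.
  induction : ∀ P : FreeGroup S ⧸ A → Prop, P (1 : FreeGroup S) →
    (∀ c x, t (mk [x] • c) = mk [x] * t c → P c → P (mk [x] • c)) → ∀ c, P c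

/-- There is a Schreier transversal that represents the cosets meeting a given standard free factor
by elements of this factor. -/
theorem exists_isSchreierTransversal (A : Subgroup (FreeGroup S)) (Y : Set S) :
    ∃ t, IsSchreierTransversal A t ∧
      ∀ y ∈ Subgroup.closure (of '' Y), t y ∈ Subgroup.closure (of '' Y) := by
  classical
  -- Leaving the alphabet `Y` outweighs any length, so a cheapest word of a coset meeting `⟨Y⟩` uses
  -- only letters of `Y`.
  let cost : List (S × Bool) → ℕ ×ₗ ℕ := fun w =>
    toLex (if ∀ x ∈ w, x.1 ∈ Y then 0 else 1, w.length)
  have cost_lt : ∀ x w, cost w < cost (x :: w) := by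
    intro x w
    simp only [cost, Prod.Lex.toLex_lt_toLex, List.length_cons]
    by_cases h : ∀ y ∈ w, y.1 ∈ Y
    · by_cases hx : x.1 ∈ Y
      · right
        have h' : ∀ y ∈ x :: w, y.1 ∈ Y := List.forall_mem_cons.2 ⟨hx, h⟩
        rw [if_pos h, if_pos h']
        simp
      · left
        have h' : ¬ ∀ y ∈ x :: w, y.1 ∈ Y := fun k => hx (k x List.mem_cons_self)
        rw [if_pos h, if_neg h']
        simp
    · right
      have h' : ¬ ∀ y ∈ x :: w, y.1 ∈ Y := fun k => h fun y hy => k y (List.mem_cons_of_mem _ hy)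
      rw [if_neg h, if_neg h']
      simp
  have hword : ∀ c : FreeGroup S ⧸ A, ∃ w : List (S × Bool), (mk w : FreeGroup S ⧸ A) = c ∧
      ∀ v : List (S × Bool), (mk v : FreeGroup S ⧸ A) = c → ¬ cost v < cost w := by
    intro c
    have hne : {w : List (S × Bool) | (mk w : FreeGroup S ⧸ A) = c}.Nonempty := by
      induction c using QuotientGroup.induction_on with
      | H g => exact ⟨g.toWord, by simp [mk_toWord]⟩
    have wf : WellFounded fun v w : List (S × Bool) => cost v < cost w :=
      InvImage.wf cost wellFounded_lt
    exact ⟨wf.min _ hne, wf.min_mem _ hne, fun v hv => wf.not_lt_min _ hv⟩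
  choose word word_mk word_min using hword
  have hparent : ∀ c : FreeGroup S ⧸ A, ∃ (p : FreeGroup S ⧸ A) (x : FreeGroup S),
      c ≠ ((1 : FreeGroup S) : FreeGroup S ⧸ A) → cost (word p) < cost (word c) ∧ x • p = c ∧
        (∃ l, x = mk [l]) ∧ (c ∈ (fun g : FreeGroup S => (g : FreeGroup S ⧸ A)) ''
          (Subgroup.closure (of '' Y) : Set (FreeGroup S)) →
          p ∈ (fun g : FreeGroup S => (g : FreeGroup S ⧸ A)) ''
          (Subgroup.closure (of '' Y) : Set (FreeGroup S)) ∧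
          x ∈ Subgroup.closure (of '' Y)) := by
    intro c
    by_cases hc : c = ((1 : FreeGroup S) : FreeGroup S ⧸ A)
    · exact ⟨c, 1, fun h => absurd hc h⟩
    · rcases hw : word c with _ | ⟨x, w⟩
      · have := word_mk c
        rw [hw] at this
        exact absurd this.symm hc
      -- The parent coset is obtained by deleting the first letter of the cheapest word.
      · refine ⟨(mk w : FreeGroup S), mk [x], fun _ => ⟨?_, ?_, ⟨x, rfl⟩, ?_⟩⟩
        · exact (not_lt.1 (word_min _ w rfl)).trans_lt (cost_lt x w)
        · rw [← word_mk c, hw]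
          change ((mk [x] * mk w : FreeGroup S) : FreeGroup S ⧸ A) = _
          simp
        · rintro ⟨y, hy, hyc⟩
          obtain ⟨v, hv, rfl⟩ := exists_mk_eq_of_mem_closure hy
          have hall : ∀ z ∈ x :: w, z.1 ∈ Y := by
            by_contra hcon
            refine word_min c v hyc ?_
            rw [hw]
            simp only [cost, Prod.Lex.toLex_lt_toLex]
            left
            rw [if_pos hv, if_neg hcon]
            exact one_pos
          exact ⟨⟨mk w, mk_mem_closure_of fun z hz => hall z (List.mem_cons_of_mem _ hz), rfl⟩,
            mk_mem_closure_of fun z hz => by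
              rw [List.mem_singleton.1 hz]; exact hall x List.mem_cons_self⟩
  choose p x hp using hparent
  have hwf : WellFounded fun c d : FreeGroup S ⧸ A => cost (word c) < cost (word d) :=
    InvImage.wf (fun c => cost (word c)) wellFounded_lt
  -- The representative is the product of letters along the chain of parents, not `mk (word c)`: the
  -- tail of `word c` need not be the word chosen for the parent.
  obtain ⟨t, ht₁, ht⟩ := exists_label_of_parent (fun c => cost (word c))
    ((1 : FreeGroup S) : FreeGroup S ⧸ A) p x (fun c hc => (hp c hc).1)
  refine ⟨t, ⟨ht₁, fun c => ?_, fun P h₁ hP c => ?_⟩, ?_⟩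
  · induction c using hwf.induction with
    | h c ih =>
      by_cases hc : c = ((1 : FreeGroup S) : FreeGroup S ⧸ A)
      · rw [hc, ht₁]
      · rw [ht c hc]
        change x c • (t (p c) : FreeGroup S ⧸ A) = c
        rw [ih _ (hp c hc).1, (hp c hc).2.1]
  · induction c using hwf.induction with
    | h c ih =>
      by_cases hc : c = ((1 : FreeGroup S) : FreeGroup S ⧸ A)
      · rwa [hc]
      · obtain ⟨hlt, hxp, ⟨l, hl⟩, -⟩ := hp c hc
        have := hP (p c) l (by rw [← hl, hxp]; exact ht c hc) (ih _ hlt)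
        rwa [← hl, hxp] at this
  · suffices h : ∀ c, c ∈ (fun g : FreeGroup S => (g : FreeGroup S ⧸ A)) ''
        (Subgroup.closure (of '' Y) : Set (FreeGroup S)) → t c ∈ Subgroup.closure (of '' Y) from
      fun y hy => h _ ⟨y, hy, rfl⟩
    intro c
    induction c using hwf.induction with
    | h c ih =>
      intro hcY
      by_cases hc : c = ((1 : FreeGroup S) : FreeGroup S ⧸ A)
      · rw [hc, ht₁]
        exact one_mem _
      · obtain ⟨hlt, -, -, hY⟩ := hp c hc
        rw [ht c hc]
        exact mul_mem (hY hcY).2 (ih _ hlt (hY hcY).1)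

/-! ### Freeness of the nontrivial Schreier generators, by a cocycle. -/

/-- The Schreier generator attached to a letter and a coset. -/
def schreierGenerator {A : Subgroup (FreeGroup S)} (t : FreeGroup S ⧸ A → FreeGroup S)
    (e : S × (FreeGroup S ⧸ A)) : FreeGroup S :=
  (t (of e.1 • e.2))⁻¹ * of e.1 * t e.2

/-- The free group on the nontrivial Schreier generators. -/
abbrev SchreierGroup {A : Subgroup (FreeGroup S)} (t : FreeGroup S ⧸ A → FreeGroup S) : Type _ :=
  FreeGroup {e : S × (FreeGroup S ⧸ A) // schreierGenerator t e ≠ 1}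

open Classical in
/-- The letter attached to a Schreier generator, or `1` if the generator is trivial. -/
noncomputable def schreierLetter {A : Subgroup (FreeGroup S)} (t : FreeGroup S ⧸ A → FreeGroup S)
    (e : S × (FreeGroup S ⧸ A)) : SchreierGroup t :=
  if h : schreierGenerator t e ≠ 1 then of ⟨e, h⟩ else 1

/-- The action of the free group on the product of the cosets with the Schreier group. -/
noncomputable def schreierAction {A : Subgroup (FreeGroup S)} (t : FreeGroup S ⧸ A → FreeGroup S) :
    FreeGroup S →* Equiv.Perm ((FreeGroup S ⧸ A) × SchreierGroup t) :=
  -- Each letter acts by a permutation, so the universal property gives the rewriting process with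
  -- no relation to check.
  FreeGroup.lift fun s =>
    { toFun := fun q => (of s • q.1, schreierLetter t (s, q.1) * q.2)
      invFun := fun q => ((of s)⁻¹ • q.1, (schreierLetter t (s, (of s)⁻¹ • q.1))⁻¹ * q.2)
      left_inv := fun q => by simp
      right_inv := fun q => by simp }

/-- The cocycle of the action `schreierAction`. -/
noncomputable def schreierCocycle {A : Subgroup (FreeGroup S)}
    (t : FreeGroup S ⧸ A → FreeGroup S) (g : FreeGroup S) (c : FreeGroup S ⧸ A) :
    SchreierGroup t :=
  (schreierAction t g (c, 1)).2

section Cocycle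

variable {A : Subgroup (FreeGroup S)} (t : FreeGroup S ⧸ A → FreeGroup S)

theorem schreierAction_of (s : S) (q : (FreeGroup S ⧸ A) × SchreierGroup t) :
    schreierAction t (of s) q = (of s • q.1, schreierLetter t (s, q.1) * q.2) := by
  simp [schreierAction]

/-- The action commutes with right multiplication on the Schreier group, so its values at `(c, 1)`
determine it. -/
theorem schreierAction_apply (g : FreeGroup S) (c : FreeGroup S ⧸ A) (l : SchreierGroup t) :
    schreierAction t g (c, l) = (g • c, schreierCocycle t g c * l) := by
  suffices h : ∀ g : FreeGroup S, ∀ q : (FreeGroup S ⧸ A) × SchreierGroup t,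
      (schreierAction t g q).1 = g • q.1 ∧ ∀ m, schreierAction t g (q.1, q.2 * m) =
        ((schreierAction t g q).1, (schreierAction t g q).2 * m) by
    have h₁ := (h g (c, 1)).1
    have h₂ := (h g (c, 1)).2 l
    rw [one_mul] at h₂
    rw [h₂, h₁, schreierCocycle]
  intro g
  induction g using FreeGroup.induction_on with
  | C1 => simp
  | of s => intro q; simp [schreierAction_of, mul_assoc]
  | inv_of s ih =>
    intro q
    obtain ⟨r, rfl⟩ := (schreierAction t (of s)).surjective q
    have h₁ := (ih r).1
    have h₂ := (ih r).2
    have hinv : ∀ p, (schreierAction t (of s)⁻¹) (schreierAction t (of s) p) = p := fun p => by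
      rw [← Equiv.Perm.mul_apply, ← _root_.map_mul, inv_mul_cancel, _root_.map_one,
        Equiv.Perm.one_apply]
    rw [hinv]
    refine ⟨by rw [h₁, inv_smul_smul], fun m => ?_⟩
    rw [← h₂ m, hinv]
  | mul g h ihg ihh =>
    intro q
    simp only [_root_.map_mul, Equiv.Perm.mul_apply]
    refine ⟨by rw [(ihg _).1, (ihh q).1, mul_smul], fun m => ?_⟩
    rw [(ihh q).2 m, (ihg _).2 m]

theorem schreierCocycle_of (s : S) (c : FreeGroup S ⧸ A) :
    schreierCocycle t (of s) c = schreierLetter t (s, c) := by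
  simp [schreierCocycle, schreierAction_of]

theorem schreierCocycle_mul (g h : FreeGroup S) (c : FreeGroup S ⧸ A) :
    schreierCocycle t (g * h) c = schreierCocycle t g (h • c) * schreierCocycle t h c := by
  conv_lhs => rw [schreierCocycle, _root_.map_mul, Equiv.Perm.mul_apply, schreierAction_apply,
    schreierAction_apply, mul_one]

@[simp]
theorem schreierCocycle_one (c : FreeGroup S ⧸ A) : schreierCocycle t 1 c = 1 := by
  simp [schreierCocycle]

theorem schreierCocycle_inv (g : FreeGroup S) (c : FreeGroup S ⧸ A) :
    schreierCocycle t g⁻¹ c = (schreierCocycle t g (g⁻¹ • c))⁻¹ := by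
  rw [eq_inv_iff_mul_eq_one]
  have h := schreierCocycle_mul t g⁻¹ g (g⁻¹ • c)
  rw [inv_mul_cancel, schreierCocycle_one, smul_inv_smul] at h
  exact h.symm

theorem schreierGenerator_mem (ht : ∀ c, (t c : FreeGroup S ⧸ A) = c)
    (e : S × (FreeGroup S ⧸ A)) : schreierGenerator t e ∈ A := by
  have h : ((of e.1 * t e.2 : FreeGroup S) : FreeGroup S ⧸ A) =
      (t (of e.1 • e.2) : FreeGroup S) := by
    rw [ht]
    change of e.1 • (t e.2 : FreeGroup S ⧸ A) = _
    rw [ht]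
  rw [schreierGenerator, mul_assoc]
  exact QuotientGroup.eq.1 h.symm

theorem lift_schreierLetter (e : S × (FreeGroup S ⧸ A)) :
    FreeGroup.lift (fun e : {e // schreierGenerator t e ≠ 1} => schreierGenerator t e.1)
      (schreierLetter t e) = schreierGenerator t e := by
  by_cases h : schreierGenerator t e = 1
  · simp [schreierLetter, h]
  · simp [schreierLetter, h]

/-- The product telescopes. For `g ∈ A` and the trivial coset the right side is `g` once `t` sends
that coset to `1`, so the cocycle writes `g` in the Schreier generators. -/
theorem lift_schreierCocycle (g : FreeGroup S) : ∀ c : FreeGroup S ⧸ A,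
    FreeGroup.lift (fun e : {e // schreierGenerator t e ≠ 1} => schreierGenerator t e.1)
      (schreierCocycle t g c) = (t (g • c))⁻¹ * g * t c := by
  induction g using FreeGroup.induction_on with
  | C1 => simp
  | of s => intro c; rw [schreierCocycle_of, lift_schreierLetter, schreierGenerator]
  | inv_of s ih =>
    intro c
    rw [schreierCocycle_inv, _root_.map_inv, ih, smul_inv_smul]
    group
  | mul g h ihg ihh =>
    intro c
    rw [schreierCocycle_mul, _root_.map_mul, ihg, ihh, mul_smul]
    group

variable {t}

/-- Only tree edges are crossed in building `t c`, and their Schreier generators are trivial; an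
inverse letter crosses such an edge backwards. -/
theorem IsSchreierTransversal.schreierCocycle_eq_one (ht : IsSchreierTransversal A t)
    (c : FreeGroup S ⧸ A) : schreierCocycle t (t c) ((1 : FreeGroup S) : FreeGroup S ⧸ A) = 1 := by
  have hs : ∀ g : FreeGroup S, g • ((1 : FreeGroup S) : FreeGroup S ⧸ A) = (g : FreeGroup S ⧸ A) :=
    fun g => by
      change ((g * 1 : FreeGroup S) : FreeGroup S ⧸ A) = _
      rw [mul_one]
  have hof : ∀ (s : S) (c : FreeGroup S ⧸ A), t (of s • c) = of s * t c →
      schreierCocycle t (of s) c = 1 := fun s c h => by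
    rw [schreierCocycle_of, schreierLetter, dif_neg]
    simp [schreierGenerator, h]
  refine ht.induction (fun c => schreierCocycle t (t c) _ = 1) ?_ ?_ c
  · rw [ht.one, schreierCocycle_one]
  · rintro c ⟨s, _ | _⟩ h ih
    · have h' : t ((of s)⁻¹ • c) = (of s)⁻¹ * t c := h
      change schreierCocycle t (t ((of s)⁻¹ • c)) _ = 1
      rw [h', schreierCocycle_mul, ih, hs, ht.mk_eq, mul_one, schreierCocycle_inv, inv_eq_one]
      apply hof
      rw [smul_inv_smul, h', mul_inv_cancel_left]
    · have h' : t (of s • c) = of s * t c := h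
      change schreierCocycle t (t (of s • c)) _ = 1
      rw [h', schreierCocycle_mul, ih, hs, ht.mk_eq, mul_one]
      exact hof s c h'

/-- The nontrivial Schreier generators are a basis of the subgroup. -/
theorem IsSchreierTransversal.exists_basis (ht : IsSchreierTransversal A t) :
    ∃ b : FreeGroupBasis {e // schreierGenerator t e ≠ 1} A,
      ∀ e, (b e : FreeGroup S) = schreierGenerator t e.1 := by
  have hs : ∀ g : FreeGroup S, g • ((1 : FreeGroup S) : FreeGroup S ⧸ A) = (g : FreeGroup S ⧸ A) :=
    fun g => by
      change ((g * 1 : FreeGroup S) : FreeGroup S ⧸ A) = _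
      rw [mul_one]
  have hA : ∀ a : A, ((a : FreeGroup S) : FreeGroup S ⧸ A) =
      ((1 : FreeGroup S) : FreeGroup S ⧸ A) := fun a =>
    (QuotientGroup.eq.2 (by simp)).symm
  -- Elements of `A` fix the trivial coset, so there the cocycle identity becomes multiplicativity.
  let β : A →* SchreierGroup t :=
    { toFun := fun a => schreierCocycle t a ((1 : FreeGroup S) : FreeGroup S ⧸ A)
      map_one' := by simp
      map_mul' := fun a b => by
        rw [Subgroup.coe_mul, schreierCocycle_mul, hs, hA] }
  let α : SchreierGroup t →* A := FreeGroup.lift fun e =>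
    ⟨schreierGenerator t e.1, schreierGenerator_mem t ht.mk_eq e.1⟩
  have hα : A.subtype.comp α =
      FreeGroup.lift (fun e : {e // schreierGenerator t e ≠ 1} => schreierGenerator t e.1) := by
    ext e
    simp [α]
  have hinv : ∀ c, (t c)⁻¹ • c = ((1 : FreeGroup S) : FreeGroup S ⧸ A) := fun c => by
    rw [inv_smul_eq_iff, hs, ht.mk_eq]
  have hαβ : ∀ a, α (β a) = a := fun a => by
    apply Subtype.ext
    have h := DFunLike.congr_fun hα (β a)
    rw [MonoidHom.comp_apply] at h
    refine h.trans ?_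
    change FreeGroup.lift _ (schreierCocycle t a _) = _
    rw [lift_schreierCocycle, hs, hA, ht.one]
    simp
  have hβα : β.comp α = MonoidHom.id _ := by
    ext ⟨⟨s, c⟩, h⟩
    simp only [MonoidHom.comp_apply, MonoidHom.id_apply, α, FreeGroup.lift_apply_of]
    change schreierCocycle t (schreierGenerator t (s, c)) _ = _
    simp only [schreierGenerator]
    -- Both transversal factors of the generator contribute `1`; only its middle letter survives.
    rw [schreierCocycle_mul, ht.schreierCocycle_eq_one, mul_one, hs, ht.mk_eq,
      schreierCocycle_mul, schreierCocycle_of, schreierCocycle_inv, hinv, ht.schreierCocycle_eq_one]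
    rw [inv_one, one_mul]
    exact dif_pos h
  refine ⟨⟨(MulEquiv.mk' ⟨α, β, DFunLike.congr_fun hβα, hαβ⟩ (_root_.map_mul α)).symm⟩, fun e => ?_⟩
  change ((α (of e) : A) : FreeGroup S) = _
  simp [α]

end Cocycle

/-! ### Subgroups meeting a standard free factor. -/

/-- If a subgroup of a free group meets a standard free factor nontrivially, then it has a basis
with an element in this factor. -/
theorem exists_basis_mem_closure (A : Subgroup (FreeGroup S)) (Y : Set S) {g : FreeGroup S}
    (hg : g ≠ 1) (hgA : g ∈ A) (hgY : g ∈ Subgroup.closure (of '' Y)) :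
    ∃ (e : Set (S × (FreeGroup S ⧸ A))) (b : FreeGroupBasis e A) (i : e),
      (b i : FreeGroup S) ∈ Subgroup.closure (of '' Y) := by
  obtain ⟨t, ht, htY⟩ := exists_isSchreierTransversal A Y
  obtain ⟨b, hb⟩ := ht.exists_basis
  by_contra! hcon
  -- These generators lie in `⟨Y⟩`, so under the contrary assumption they are trivial.
  have htriv : ∀ s ∈ Y, ∀ y ∈ Subgroup.closure (of '' Y),
      t (of s • (y : FreeGroup S ⧸ A)) = of s * t (y : FreeGroup S ⧸ A) := by
    intro s hs y hy
    by_contra hne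
    have hsY : of s ∈ Subgroup.closure (of '' Y) := Subgroup.subset_closure ⟨s, hs, rfl⟩
    have hne' : schreierGenerator t (s, (y : FreeGroup S ⧸ A)) ≠ 1 := fun h => hne <| by
      rwa [schreierGenerator, mul_assoc, inv_mul_eq_one] at h
    refine hcon _ b ⟨_, hne'⟩ ?_
    rw [hb]
    exact mul_mem (mul_mem (inv_mem (htY (of s * y) (mul_mem hsY hy))) hsY) (htY y hy)
  have hfix : ∀ y ∈ Subgroup.closure (of '' Y), t (y : FreeGroup S ⧸ A) = y := by
    intro y hy
    induction hy using Subgroup.closure_induction_left with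
    | one => exact ht.one
    | mul_left x hx y hy ih =>
      obtain ⟨s, hs, rfl⟩ := hx
      exact (htriv s hs y hy).trans (by rw [ih])
    | inv_mul_cancel x hx y hy ih =>
      obtain ⟨s, hs, rfl⟩ := hx
      have hsY : of s ∈ Subgroup.closure (of '' Y) := Subgroup.subset_closure ⟨s, hs, rfl⟩
      have h := htriv s hs ((of s)⁻¹ * y) (mul_mem (inv_mem hsY) hy)
      change t ((of s * ((of s)⁻¹ * y) : FreeGroup S) : FreeGroup S ⧸ A) = _ at h
      rw [mul_inv_cancel_left, ih] at h
      exact (eq_inv_mul_iff_mul_eq.2 h.symm)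
  refine hg ?_
  -- Since `g` and `1` lie in the same coset, `g = t g = t 1 = 1`.
  rw [← hfix g hgY, ← ht.one]
  exact congrArg t (QuotientGroup.eq.2 (by simpa using hgA)).symm

end FreeGroup

/-! ### Free splittings and bases. -/

section Splittings

variable {G : Type*} [Group G] {A B : Subgroup G}

theorem IsFreeSplitting.symm (h : IsFreeSplitting A B) : IsFreeSplitting B A := by
  have h' : (Monoid.Coprod.lift B.subtype A.subtype : Monoid.Coprod B A → G) =
      Monoid.Coprod.lift A.subtype B.subtype ∘ MulEquiv.coprodComm B A := by
    rw [← Monoid.Coprod.lift_comp_swap]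
    rfl
  rw [IsFreeSplitting, h']
  exact h.comp (MulEquiv.coprodComm B A).bijective

theorem IsFreeSplitting.conj (h : IsFreeSplitting A B) (x : G) :
    IsFreeSplitting (conjSubgroup x A) (conjSubgroup x B) := by
  let e := MulAut.conj x
  let eA : A ≃* conjSubgroup x A := e.subgroupMap A
  let eB : B ≃* conjSubgroup x B := e.subgroupMap B
  have h' : (Monoid.Coprod.lift (conjSubgroup x A).subtype (conjSubgroup x B).subtype).comp
      (MulEquiv.coprodCongr eA eB).toMonoidHom =
        e.toMonoidHom.comp (Monoid.Coprod.lift A.subtype B.subtype) :=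
    Monoid.Coprod.hom_ext rfl rfl
  have hb : Function.Bijective (e ∘ Monoid.Coprod.lift A.subtype B.subtype) := e.bijective.comp h
  have h'' : (Monoid.Coprod.lift (conjSubgroup x A).subtype (conjSubgroup x B).subtype) ∘
      (MulEquiv.coprodCongr eA eB) = e ∘ Monoid.Coprod.lift A.subtype B.subtype :=
    congrArg DFunLike.coe h'
  rw [← h''] at hb
  exact (Function.Bijective.of_comp_iff _ (MulEquiv.coprodCongr eA eB).bijective).1 hb

/-- Bases of the factors of a free splitting form a basis of the group. -/
theorem IsFreeSplitting.exists_basis (h : IsFreeSplitting A B) {ι κ : Type*}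
    (b : FreeGroupBasis ι A) (c : FreeGroupBasis κ B) :
    ∃ d : FreeGroupBasis (ι ⊕ κ) G, (∀ i, d (Sum.inl i) = b i) ∧ ∀ j, d (Sum.inr j) = c j := by
  let f : FreeGroup (ι ⊕ κ) →* Monoid.Coprod A B := FreeGroup.lift
    (Sum.elim (fun i => Monoid.Coprod.inl (b i)) fun j => Monoid.Coprod.inr (c j))
  let g : Monoid.Coprod A B →* FreeGroup (ι ⊕ κ) := Monoid.Coprod.lift
    (b.lift fun i => FreeGroup.of (Sum.inl i)) (c.lift fun j => FreeGroup.of (Sum.inr j))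
  have hb : ∀ i, g (Monoid.Coprod.inl (b i)) = FreeGroup.of (Sum.inl i) := fun i => by simp [g]
  have hc : ∀ j, g (Monoid.Coprod.inr (c j)) = FreeGroup.of (Sum.inr j) := fun j => by simp [g]
  have hgf : g.comp f = MonoidHom.id _ := by
    ext x
    rcases x with i | j
    · simpa [f] using hb i
    · simpa [f] using hc j
  have hfg : f.comp g = MonoidHom.id _ := by
    apply Monoid.Coprod.hom_ext
    · apply b.ext_hom
      intro i
      simp only [MonoidHom.comp_apply, hb]
      simp [f]
    · apply c.ext_hom
      intro j
      simp only [MonoidHom.comp_apply, hc]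
      simp [f]
  let e : FreeGroup (ι ⊕ κ) ≃* G := (f.toMulEquiv g hgf hfg).trans (MulEquiv.ofBijective _ h)
  refine ⟨⟨e.symm⟩, fun i => ?_, fun j => ?_⟩
  · change Monoid.Coprod.lift A.subtype B.subtype (f (FreeGroup.of (Sum.inl i))) = _
    simp [f]
  · change Monoid.Coprod.lift A.subtype B.subtype (f (FreeGroup.of (Sum.inr j))) = _
    simp [f]

end Splittings

/-- Bases of isomorphic free groups are equipotent, so matching `ι` with `X` turns the basis into an
automorphism. -/
theorem FreeGroupBasis.isPrimitiveElement {X ι : Type*} (b : FreeGroupBasis ι (FreeGroup X))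
    (i : ι) : IsPrimitiveElement (b i) := by
  let e : ι ≃ X := Equiv.ofFreeGroupEquiv b.repr.symm
  exact ⟨(FreeGroup.freeGroupCongr e).symm.trans b.repr.symm, e i, by
    rw [FreeGroup.freeGroupCongr_symm, MulEquiv.trans_apply]
    simp only [FreeGroup.freeGroupCongr_apply, FreeGroup.map.of, Equiv.symm_apply_apply]
    rfl⟩

/-! ### Primitive elements common to two free factors. -/

section PrimitiveWords

variable {X : Type*}

/-- Two free factors of a free group that meet nontrivially share a primitive element. -/
theorem exists_isPrimitiveElement_mem {A B C D : Subgroup (FreeGroup X)}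
    (hAB : IsFreeSplitting A B) (hCD : IsFreeSplitting C D) {g : FreeGroup X} (hg : g ≠ 1)
    (hgA : g ∈ A) (hgC : g ∈ C) : ∃ p ∈ A, p ∈ C ∧ IsPrimitiveElement p := by
  obtain ⟨d, hd, -⟩ := hCD.exists_basis (IsFreeGroup.basis C) (IsFreeGroup.basis D)
  let c := IsFreeGroup.basis C
  let Y : Set (IsFreeGroup.Generators C ⊕ IsFreeGroup.Generators D) := Set.range Sum.inl
  -- `hmem` and `hmem'` together identify `C`, in the coordinates of `d`, with the standard factor
  -- on `Y`.
  have hmem : ∀ x ∈ C, d.repr x ∈ Subgroup.closure (FreeGroup.of '' Y) := by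
    have key : ∀ x : C, d.repr x = FreeGroup.map Sum.inl (c.repr x) := by
      refine DFunLike.congr_fun (c.ext_hom (d.repr.toMonoidHom.comp C.subtype)
        ((FreeGroup.map Sum.inl).comp c.repr.toMonoidHom) fun i => ?_)
      change d.repr (c i : FreeGroup X) = FreeGroup.map Sum.inl (c.repr (c i))
      rw [← hd, FreeGroupBasis.repr_apply_coe, FreeGroupBasis.repr_apply_coe, FreeGroup.map.of]
    intro x hx
    rw [key ⟨x, hx⟩]
    generalize c.repr ⟨x, hx⟩ = w
    induction w using FreeGroup.induction_on with
    | C1 => exact one_mem _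
    | of i => exact Subgroup.subset_closure ⟨Sum.inl i, ⟨i, rfl⟩, by simp⟩
    | inv_of i ih => rw [map_inv]; exact inv_mem ih
    | mul v w hv hw => rw [map_mul]; exact mul_mem hv hw
  have hmem' : Subgroup.closure (FreeGroup.of '' Y) ≤ C.comap d.repr.symm.toMonoidHom := by
    rw [Subgroup.closure_le]
    rintro _ ⟨_, ⟨i, rfl⟩, rfl⟩
    change d (Sum.inl i) ∈ C
    rw [hd]
    exact SetLike.coe_mem _
  obtain ⟨e, b, i, hi⟩ := FreeGroup.exists_basis_mem_closure (A.map d.repr.toMonoidHom) Y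
    (g := d.repr g) (by simpa using hg) ⟨g, hgA, rfl⟩ (hmem g hgC)
  let b' := b.map (d.repr.subgroupMap A).symm
  have hb' : d.repr (b' i : FreeGroup X) = b i :=
    congrArg Subtype.val ((d.repr.subgroupMap A).apply_symm_apply (b i))
  -- `B` is free by Nielsen–Schreier, so the basis of `A` extends to the whole group.
  obtain ⟨f, hf, -⟩ := hAB.exists_basis b' (IsFreeGroup.basis B)
  refine ⟨b' i, SetLike.coe_mem _, ?_, ?_⟩
  · have := hmem' hi
    rw [← hb'] at this
    simpa using this
  · rw [← hf]
    exact f.isPrimitiveElement _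

/-- An element elliptic to a splitting lies in a free factor consisting of elliptic elements. -/
theorem ProperFreeSplitting.IsElliptic.exists_factor {G : Type*} [Group G]
    {S : ProperFreeSplitting G} {g : G} (h : S.IsElliptic g) :
    ∃ A B : Subgroup G, IsFreeSplitting A B ∧ g ∈ A ∧ ∀ p ∈ A, S.IsElliptic p := by
  obtain ⟨x, h | h⟩ := h
  · exact ⟨_, _, S.isFreeSplitting.conj x, h, fun p hp => ⟨x, Or.inl hp⟩⟩
  · exact ⟨_, _, S.isFreeSplitting.symm.conj x, h, fun p hp => ⟨x, Or.inr hp⟩⟩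

namespace SplittingClass

theorem IsElliptic.exists_factor {G : Type*} [Group G] {c : SplittingClass G} {g : G}
    (h : c.IsElliptic g) :
    ∃ A B : Subgroup G, IsFreeSplitting A B ∧ g ∈ A ∧ ∀ p ∈ A, c.IsElliptic p := by
  induction c using Quotient.inductionOn with
  | h S => exact ProperFreeSplitting.IsElliptic.exists_factor h

/-- Allows a single representative of a cyclic word to be tested against both splitting classes. -/
theorem IsElliptic.of_isConj {G : Type*} [Group G] {c : SplittingClass G} {g h : G}
    (hg : c.IsElliptic g) (hgh : IsConj g h) : c.IsElliptic h := by
  induction c using Quotient.inductionOn with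
  | h S =>
    obtain ⟨y, rfl⟩ := isConj_iff.1 hgh
    have key : ∀ {x : G} {A : Subgroup G}, g ∈ conjSubgroup x A →
        y * g * y⁻¹ ∈ conjSubgroup (y * x) A := fun {x A} hx => by
      rw [← conjSubgroup_mul, mem_conjSubgroup]
      exact ⟨g, hx, rfl⟩
    obtain ⟨x, hx⟩ := (hg : S.IsElliptic g)
    exact (⟨y * x, hx.imp key key⟩ : S.IsElliptic _)

/-- If a nontrivial element is elliptic to two classes of splittings, then some primitive element
is elliptic to both. -/
theorem IsElliptic.exists_isPrimitiveElement {c d : SplittingClass (FreeGroup X)} {g : FreeGroup X}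
    (hg : g ≠ 1) (hc : c.IsElliptic g) (hd : d.IsElliptic g) :
    ∃ p, IsPrimitiveElement p ∧ c.IsElliptic p ∧ d.IsElliptic p := by
  obtain ⟨A, B, hAB, hgA, hA⟩ := hc.exists_factor
  obtain ⟨C, D, hCD, hgC, hC⟩ := hd.exists_factor
  obtain ⟨p, hpA, hpC, hp⟩ := exists_isPrimitiveElement_mem hAB hCD hg hgA hgC
  exact ⟨p, hp, hA p hpA, hC p hpC⟩

end SplittingClass

theorem IsPrimitiveElement.ne_one {g : FreeGroup X} (hg : IsPrimitiveElement g) : g ≠ 1 := by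
  obtain ⟨φ, x, rfl⟩ := hg
  simp

theorem snd_eq_of_ne_inv {α : Type*} {a b : α × Bool} :
    b ≠ (a.1, !a.2) ↔ (a.1 = b.1 → a.2 = b.2) := by
  obtain ⟨a, s⟩ := a
  obtain ⟨b, t⟩ := b
  cases s <;> cases t <;> simp [eq_comm]

/-! ### Cyclic words and conjugacy classes. -/

namespace CyclicWord

theorem chain_coe_iff (l : List (X × Bool)) :
    ((l : Cycle (X × Bool)).Chain fun a b => b ≠ (a.1, !a.2)) ↔
      FreeGroup.IsCyclicallyReduced l := by
  rcases l with _ | ⟨a, l⟩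
  · simp
  -- The cyclic chain on `a :: l` is a linear chain on `a :: l ++ [a]`; splitting off the final `a`
  -- isolates the wrap-around condition.
  · rw [Cycle.chain_coe_cons, FreeGroup.isCyclicallyReduced_iff, FreeGroup.IsReduced,
      ← List.cons_append, List.isChain_append]
    simp only [snd_eq_of_ne_inv]
    simp

/-- Every element of the free group represents a cyclic word. -/
theorem exists_represents (g : FreeGroup X) : ∃ w : CyclicWord X, Represents g w := by
  classical
  let l := FreeGroup.reduceCyclically g.toWord
  refine ⟨⟨(l : Cycle (X × Bool)), (chain_coe_iff l).2
    (FreeGroup.reduceCyclically.isCyclicallyReduced FreeGroup.isReduced_toWord)⟩, ?_⟩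
  change ConjClasses.mk g = ConjClasses.mk (FreeGroup.mk l)
  rw [ConjClasses.mk_eq_mk_iff_isConj, isConj_comm, isConj_iff]
  refine ⟨FreeGroup.mk (FreeGroup.reduceCyclically.conjugator g.toWord), ?_⟩
  rw [FreeGroup.inv_mk, FreeGroup.mul_mk, FreeGroup.mul_mk,
    FreeGroup.reduceCyclically.conj_conjugator_reduceCyclically, FreeGroup.mk_toWord]

/-- The identity is conjugate only to itself, and a reduced list that spells it is empty. -/
theorem IsNontrivial.ne_one {w : CyclicWord X} (hw : w.IsNontrivial) {g : FreeGroup X}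
    (hg : Represents g w) : g ≠ 1 := by
  classical
  rintro rfl
  obtain ⟨c, hc⟩ := w
  induction c using Quotient.inductionOn with
  | h l =>
    have h₁ : IsConj (1 : FreeGroup X) (FreeGroup.mk l) := ConjClasses.mk_eq_mk_iff_isConj.1 hg
    have h₂ : FreeGroup.mk l = 1 := isConj_one_right.1 h₁
    have h₃ : FreeGroup.IsReduced l := ((chain_coe_iff l).1 hc).isReduced
    have h₄ := congrArg FreeGroup.toWord h₂
    rw [FreeGroup.toWord_mk, h₃.reduce_eq, FreeGroup.toWord_one] at h₄
    subst h₄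
    exact hw rfl

theorem Represents.isNontrivial {w : CyclicWord X} {g : FreeGroup X} (hg : Represents g w)
    (h : g ≠ 1) : w.IsNontrivial := by
  intro hw
  obtain ⟨c, hc⟩ := w
  change c = Cycle.nil at hw
  subst hw
  have h₁ : IsConj g 1 := ConjClasses.mk_eq_mk_iff_isConj.1 hg
  exact h (isConj_one_left.1 h₁)

/-- If a nontrivial cyclic word is elliptic to two classes of splittings, then some primitive
cyclic word is elliptic to both. -/
theorem exists_isPrimitive_isEllipticTo {w : CyclicWord X} (hw : w.IsNontrivial)
    {c d : SplittingClass (FreeGroup X)} (hc : w.IsEllipticTo c) (hd : w.IsEllipticTo d) :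
    ∃ v : CyclicWord X, v.IsNontrivial ∧ v.IsPrimitive ∧ v.IsEllipticTo c ∧ v.IsEllipticTo d := by
  obtain ⟨g, hgw, hgc⟩ := hc
  obtain ⟨h, hhw, hhd⟩ := hd
  have hconj : IsConj h g := ConjClasses.mk_eq_mk_iff_isConj.1 (hhw.trans hgw.symm)
  obtain ⟨p, hp, hpc, hpd⟩ := hgc.exists_isPrimitiveElement (hw.ne_one hgw) (hhd.of_isConj hconj)
  obtain ⟨v, hv⟩ := exists_represents p
  exact ⟨v, hv.isNontrivial hp.ne_one, ⟨p, hv, hp⟩, ⟨p, hv, hpc⟩, ⟨p, hv, hpd⟩⟩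

end CyclicWord

/-! ### Rerouting walks through primitive words. -/

/-- A vertex outside the primitive subgraph that joins two vertices, the first of them in the
primitive subgraph, can be replaced by a vertex of the primitive subgraph. -/
theorem exists_adj_primitiveVertices {a b c : EllipticityVertex X} (ha : a ∈ primitiveVertices X)
    (hb : b ∉ primitiveVertices X) (hab : (ellipticityGraph X).Adj a b)
    (hbc : (ellipticityGraph X).Adj b c) :
    c ∈ primitiveVertices X ∧ ∃ d ∈ primitiveVertices X, (ellipticityGraph X).Adj a d ∧
      (ellipticityGraph X).Adj d c := by
  rcases b with b | w
  · exact absurd (fun w hw => by simp at hw) hb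
  rcases a with a | a
  · rcases c with c | c
    · obtain ⟨v, hv, hvp, hva, hvc⟩ := CyclicWord.exists_isPrimitive_isEllipticTo w.2 hab hbc
      refine ⟨fun u hu => by simp at hu, Sum.inr ⟨v, hv⟩, fun u hu => ?_, hva, hvc⟩
      rw [← Sum.inr.inj hu]
      exact hvp
    · exact hbc.elim
  · exact hab.elim

/-- Walks of the ellipticity graph between vertices of the primitive subgraph can be replaced by
walks of the same length in the primitive subgraph. -/
theorem exists_walk_primitiveEllipticityGraph (n : ℕ) : ∀ (u v : primitiveVertices X)
    (p : (ellipticityGraph X).Walk u v), p.length = n →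
      ∃ q : (primitiveEllipticityGraph X).Walk u v, q.length = n := by
  induction n using Nat.strong_induction_on with
  | h n ih =>
    rintro ⟨u, hu⟩ ⟨v, hv⟩ p hp
    change (ellipticityGraph X).Walk u v at p
    cases p with
    | nil => exact ⟨.nil, hp⟩
    | @cons _ b _ hab p =>
      rw [SimpleGraph.Walk.length_cons] at hp
      by_cases hb : b ∈ primitiveVertices X
      · obtain ⟨q, hq⟩ := ih p.length (by omega) ⟨b, hb⟩ ⟨v, hv⟩ p rfl
        have h : (primitiveEllipticityGraph X).Adj ⟨u, hu⟩ ⟨b, hb⟩ := hab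
        exact ⟨.cons h q, by rw [SimpleGraph.Walk.length_cons]; omega⟩
      -- A rerouting consumes two edges at once, hence the strong induction; the walk cannot stop at
      -- `b`, as its end is in the primitive subgraph.
      · cases p with
        | nil => exact absurd hv hb
        | @cons _ c _ hbc p =>
          rw [SimpleGraph.Walk.length_cons] at hp
          obtain ⟨hc, d, hd, had, hdc⟩ := exists_adj_primitiveVertices hu hb hab hbc
          obtain ⟨q, hq⟩ := ih p.length (by omega) ⟨c, hc⟩ ⟨v, hv⟩ p rfl
          have h₁ : (primitiveEllipticityGraph X).Adj ⟨u, hu⟩ ⟨d, hd⟩ := had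
          have h₂ : (primitiveEllipticityGraph X).Adj ⟨d, hd⟩ ⟨c, hc⟩ := hdc
          exact ⟨.cons h₁ (.cons h₂ q), by simp only [SimpleGraph.Walk.length_cons]; omega⟩

end PrimitiveWords

theorem mainTheorem6 {X : Type*} (u v : primitiveVertices X) :
    (ellipticityGraph X).edist (primitiveInclusion X u) (primitiveInclusion X v) =
      (primitiveEllipticityGraph X).edist u v := by
  apply le_antisymm
  -- The distance is an infimum over walks, so the case of no walk, with value `⊤`, needs no
  -- separate treatment.
  · refine le_iInf fun q => ?_
    have h := SimpleGraph.edist_le (q.map (primitiveInclusion X).toHom)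
    rwa [SimpleGraph.Walk.length_map] at h
  · refine le_iInf fun p => ?_
    obtain ⟨q, hq⟩ := exists_walk_primitiveEllipticityGraph p.length u v p rfl
    rw [← hq]
    exact SimpleGraph.edist_le q
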